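/- A separation system $(\vec S,\le,{}^*)$ is a partially ordered set with an order-reversing involution. An element $\vec s$ is small if $\vec s\le \vec s^{\,*}$, degenerate if $\vec s=\vec s^{\,*}$, and trivial if there is $\vec r\in\vec S$ with $\vec s<\vec r$ and $\vec s<\vec r^{\,*}$. The system is regular if it has no small elements. It is a tree set if it has no trivial and no degenerate elements and is nested, i.e. any two of its elements $\vec r,\vec s$ are such that one of $\vec r,\vec r^{\,*}$ is comparable with one of $\vec s,\vec s^{\,*}$. An orientation of $\vec S$ is a subset $O$ containing exactly one element of each set $\{\vec s,\vec s^{\,*}\}$; it is consistent if there are no $\vec r,\vec s\in O$ with $\{\vec r,\vec r^{\,*}\}\neq\{\vec s,\vec s^{\,*}\}$ and $\vec r^{\,*}<\vec s$. A corridor of a subset $O\subseteq\vec S$ is a class of the relation on $O$ in which $\vec s_1,\vec s_2\in O$ are related if there is $\vec r\in O$ with $\vec s_1,\vec s_2\le\vec r$ (an equivalence relation in all cases below). For $O\subseteq\vec S$, let $\vec S[O]$ be the separation system $O\cup O^*$ with the ordering and involution induced from $\vec S$, where $O^*=\{\vec s^{\,*}:\vec s\in O\}$. An isomorphism of separation systems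 is an order isomorphism that commutes with the involutions. An (oriented) separation of a graph $G=(V,E)$ is a pair $(A,B)$ with $A\cup B=V$ such that $G$ has no edge between $A\setminus B$ and $B\setminus A$; its separator is $A\cap B$, its order is $|A\cap B|$, $(A,B)\le(C,D)$ means $A\subseteq C$ and $B\supseteq D$, and $(A,B)^*=(B,A)$. Let $\vec S_{\aleph_0}$ be the system of all finite-order separations of $G$. The supremum of a set $L$ of separations is $\big(\bigcup_{(C,D)\in L}C,\ \bigcap_{(C,D)\in L}D\big)$. For a consistent orientation $O$ of a regular tree set of finite-order separations of $G$ and $n\in\mathbb N$, let $O_{\le n}$ be the set of elements of $O$ of order at most $n$, and let $\pi_n(O)$ be the set of the suprema of the corridors of $O_{\le n}$. The parliament of $O$ is $\pi(O)=\bigcup_{n\in\mathbb N}\pi_n(O)$; its elements have finite order. The edge tree set of a tree $F$ is the set of all oriented edges $(x,y)$ of $F$ with $(x,y)^*=(y,x)$, where $(x,y)<(u,v)$ if and only if $\{x,y\}\ne\{u,v\}$ and the unique $\{x,y\}$–$\{u,v\}$ path in $F$ joins $y$ to $u$. **Theorem 3.8.** Let $G$ be any graph, let $\vec T$ be any regular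 tree set of finite-order separations of $G$, and let $O$ be any consistent orientation of $\vec T$ such that $\vec S_{\aleph_0}[\pi(O)]$ is regular. Then for every corridor $\gamma$ of the parliament $\pi(O)$, the separation system $\vec S_{\aleph_0}[\gamma]$ is a regular tree set of finite-order separations of $G$, and it is isomorphic to the edge tree set of a tree. -/

import Mathlib

universe u v

/-! Separation systems -/

/-- A separation system: a partially ordered set with an order-reversing involution. -/
class SeparationSystem (S : Type u) extends PartialOrder S where
  inv : S → S
  inv_inv : ∀ s : S, inv (inv s) = s
  inv_le_inv : ∀ r s : S, r ≤ s → inv s ≤ inv r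

namespace SeparationSystem

variable {S : Type u} [SeparationSystem S]

/-- `X`, with the ordering and involution of the ambient system, is a separation system. -/
def IsSubsystem (X : Set S) : Prop := ∀ s ∈ X, inv s ∈ X

/-- Two separations are nested if they have comparable orientations. -/
def Nested (r s : S) : Prop := r ≤ s ∨ r ≤ inv s ∨ inv r ≤ s ∨ inv r ≤ inv s

/-- `s` is trivial in `X`, with a witness that lies in `X`. -/
def IsTrivialIn (X : Set S) (s : S) : Prop := ∃ r ∈ X, s < r ∧ s < inv r

/-- A tree set: a nested separation system without trivial and without degenerate elements. -/
structure IsTreeSet (X : Set S) : Prop where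
  subsystem : IsSubsystem X
  nested : ∀ r ∈ X, ∀ s ∈ X, Nested r s
  not_trivial : ∀ s ∈ X, ¬ IsTrivialIn X s
  not_degenerate : ∀ s ∈ X, inv s ≠ s

/-- `X` has no small elements. -/
def IsRegular (X : Set S) : Prop := ∀ s ∈ X, ¬ s ≤ inv s

/-- `O` is an orientation of `X`: it contains exactly one of the orientations `s`, `inv s` of each
separation. -/
structure IsOrientation (X O : Set S) : Prop where
  subset : O ⊆ X
  total : ∀ s ∈ X, s ∈ O ∨ inv s ∈ O
  unique : ∀ s ∈ O, inv s ∈ O → inv s = s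

/-- `O` is consistent: no two elements of `O` that orient distinct separations
point away from each other. -/
def IsConsistent (O : Set S) : Prop := ∀ r ∈ O, ∀ s ∈ O, r ≠ s → ¬ inv r < s

/-- `γ` is a corridor of `O`: a class of the relation on `O` of having a common upper bound
in `O`. -/
def IsCorridor (O γ : Set S) : Prop :=
  ∃ s ∈ O, γ = {t | t ∈ O ∧ ∃ r ∈ O, s ≤ r ∧ t ≤ r}

/-- The separation system induced by `O`, consisting of the elements of `O` and their inverses. -/
def induced (O : Set S) : Set S := {s | s ∈ O ∨ inv s ∈ O}

instance inducedSystem (O : Set S) : SeparationSystem (induced O) where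
  inv s := ⟨inv s.1, s.2.elim (fun h => Or.inr (by rwa [inv_inv])) Or.inl⟩
  inv_inv s := Subtype.ext (inv_inv s.1)
  inv_le_inv r s h := inv_le_inv r.1 s.1 h

/-- An isomorphism of separation systems. -/
structure Iso (S : Type u) (S' : Type v) [SeparationSystem S] [SeparationSystem S']
    extends S ≃o S' where
  map_inv : ∀ s : S, toFun (inv s) = inv (toFun s)

end SeparationSystem

/-! Separations of graphs -/

/-- An oriented separation `(A, B)` of a graph. -/
@[ext]
structure GraphSep {V : Type u} (G : SimpleGraph V) where
  A : Set V
  B : Set V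
  cover : A ∪ B = Set.univ
  no_edge : ∀ a ∈ A \ B, ∀ b ∈ B \ A, ¬ G.Adj a b

namespace GraphSep

variable {V : Type u} {G : SimpleGraph V}

/-- `(A, B) ≤ (C, D)` if `A ⊆ C` and `D ⊆ B`, and the inverse of `(A, B)` is `(B, A)`. -/
instance : SeparationSystem (GraphSep G) where
  le s t := s.A ⊆ t.A ∧ t.B ⊆ s.B
  le_refl s := ⟨subset_rfl, subset_rfl⟩
  le_trans r s t h k := ⟨h.1.trans k.1, k.2.trans h.2⟩
  le_antisymm s t h k := GraphSep.ext (h.1.antisymm k.1) (k.2.antisymm h.2)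
  inv s := ⟨s.B, s.A, by rw [Set.union_comm, s.cover],
    fun a ha b hb hab => s.no_edge b hb a ha hab.symm⟩
  inv_inv _ := rfl
  inv_le_inv r s h := ⟨h.2, h.1⟩

def separator (s : GraphSep G) : Set V := s.A ∩ s.B

/-- The set of all oriented separations of finite order. -/
def finiteOrder (G : SimpleGraph V) : Set (GraphSep G) := {s | s.separator.Finite}

/-- The supremum `(⋃ C, ⋂ D)` of a set of oriented separations `(C, D)`. -/
def sup (L : Set (GraphSep G)) : GraphSep G where
  A := ⋃ s ∈ L, s.A
  B := ⋂ s ∈ L, s.B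
  cover := by
    refine Set.eq_univ_of_forall fun x => ?_
    by_cases hx : x ∈ ⋂ s ∈ L, s.B
    · exact Or.inr hx
    · simp only [Set.mem_iInter, not_forall] at hx
      obtain ⟨s, hs, hxs⟩ := hx
      have h : x ∈ s.A ∪ s.B := s.cover ▸ Set.mem_univ x
      exact Or.inl (Set.mem_biUnion hs (h.resolve_right hxs))
  no_edge := by
    rintro a ⟨-, ha⟩ b ⟨hb, hb'⟩
    simp only [Set.mem_iInter, not_forall] at ha
    obtain ⟨s, hs, has⟩ := ha
    have h : a ∈ s.A ∪ s.B := s.cover ▸ Set.mem_univ a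
    exact s.no_edge a ⟨h.resolve_right has, has⟩ b
      ⟨Set.mem_iInter₂.1 hb s hs, fun hbs => hb' (Set.mem_biUnion hs hbs)⟩

/-- The elements of `O` whose separators have size at most `n`. -/
def orderLE (O : Set (GraphSep G)) (n : ℕ) : Set (GraphSep G) :=
  {s | s ∈ O ∧ s.separator.encard ≤ n}

/-- The suprema of the corridors of the set of elements of `O` of order at most `n`. -/
def parliamentLevel (O : Set (GraphSep G)) (n : ℕ) : Set (GraphSep G) :=
  {s | ∃ γ, SeparationSystem.IsCorridor (orderLE O n) γ ∧ s = sup γ}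

def parliament (O : Set (GraphSep G)) : Set (GraphSep G) := ⋃ n : ℕ, parliamentLevel O n

end GraphSep

/-! The edge tree set of a tree -/

namespace SimpleGraph

variable {W : Type u} {F : SimpleGraph W}

/-- `(x, y) ≤ (u, v)` if these oriented edges are equal, or if their underlying edges are distinct
and the path between `{x, y}` and `{u, v}` joins `y` to `u`. -/
def dartLE (d e : F.Dart) : Prop :=
  d = e ∨ (d.edge ≠ e.edge ∧
    ∃ p : F.Walk d.snd e.fst, p.IsPath ∧ d.fst ∉ p.support ∧ e.snd ∉ p.support)

/-- In an acyclic graph, the edges `d`, `e` and the path between them form one path. -/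
theorem dartLE_iff (hF : F.IsAcyclic) (d e : F.Dart) :
    dartLE d e ↔ d = e ∨
      ∃ p : F.Walk d.snd e.fst, (Walk.cons d.adj (p.concat e.adj)).IsPath := by
  refine or_congr Iff.rfl ⟨?_, ?_⟩
  · rintro ⟨hne, p, hp, hd, he⟩
    refine ⟨p, (hF.isPath_iff_isChain _).2 ?_⟩
    have h1 : (Walk.cons d.adj p).IsPath := hp.cons hd
    have h2 : (p.concat e.adj).IsPath := hp.concat he e.adj
    rw [hF.isPath_iff_isChain] at h1 h2
    rw [Walk.edges_cons] at h1 ⊢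
    rw [Walk.edges_concat, List.concat_eq_append] at h2 ⊢
    by_cases hnil : p.edges = []
    · rw [hnil]
      rw [List.nil_append, List.isChain_pair]
      exact hne
    · exact List.IsChain.append_overlap (l₁ := [_]) h1 h2 hnil
  · rintro ⟨p, h⟩
    have hs := h.support_nodup
    rw [Walk.support_cons, Walk.support_concat, List.nodup_cons,
      List.mem_append, not_or] at hs
    obtain ⟨⟨h1, -⟩, h2⟩ := hs
    have h3 := List.nodup_append.1 h2
    refine ⟨?_, p, Walk.IsPath.mk' h3.1, h1, fun hv => h3.2.2 _ hv _ (by simp) rfl⟩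
    intro heq
    have := h.edges_nodup
    rw [Walk.edges_cons, Walk.edges_concat, List.concat_eq_append, List.nodup_cons] at this
    apply this.1
    have heq' : s(d.fst, d.snd) = s(e.fst, e.snd) := heq
    rw [heq']
    simp

theorem dartPath_trans (hF : F.IsAcyclic) {d e f : F.Dart}
    (p : F.Walk d.snd e.fst) (hp : (Walk.cons d.adj (p.concat e.adj)).IsPath)
    (q : F.Walk e.snd f.fst) (hq : (Walk.cons e.adj (q.concat f.adj)).IsPath) :
    ∃ r : F.Walk d.snd f.fst, (Walk.cons d.adj (r.concat f.adj)).IsPath := by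
  refine ⟨p.append (Walk.cons e.adj q), ?_⟩
  rw [hF.isPath_iff_isChain] at hp hq ⊢
  simp only [Walk.edges_cons, Walk.edges_concat, List.concat_eq_append, Walk.edges_append]
    at hp hq ⊢
  have := List.IsChain.append_overlap (l₁ := s(d.fst, d.snd) :: p.edges)
    (l₂ := [s(e.fst, e.snd)]) (by simpa using hp) hq (by simp)
  simpa using this

theorem dartLE_trans (hF : F.IsAcyclic) {d e f : F.Dart} (h : dartLE d e) (k : dartLE e f) :
    dartLE d f := by
  rw [dartLE_iff hF] at *
  rcases h with rfl | ⟨p, hp⟩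
  · exact k
  rcases k with rfl | ⟨q, hq⟩
  · exact Or.inr ⟨p, hp⟩
  · exact Or.inr (dartPath_trans hF p hp q hq)

theorem dartLE_antisymm (hF : F.IsAcyclic) {d e : F.Dart} (h : dartLE d e) (k : dartLE e d) :
    d = e := by
  rw [dartLE_iff hF] at *
  rcases h with rfl | ⟨p, hp⟩
  · rfl
  rcases k with rfl | ⟨q, hq⟩
  · rfl
  obtain ⟨r, hr⟩ := dartPath_trans hF p hp q hq
  have := hr.support_nodup
  rw [Walk.support_cons, List.nodup_cons] at this
  exact absurd (by simp [Walk.support_concat]) this.1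

theorem dartLE_symm {d e : F.Dart} (h : dartLE d e) : dartLE e.symm d.symm := by
  rcases h with rfl | ⟨hne, p, hp, hd, he⟩
  · exact Or.inl rfl
  · exact Or.inr ⟨by simpa using hne.symm, p.reverse, hp.reverse, fun h => he (List.mem_reverse.1 (p.support_reverse ▸ h)),
      fun h => hd (List.mem_reverse.1 (p.support_reverse ▸ h))⟩

/-- The set of oriented edges of a tree. -/
def EdgeTreeSet (F : SimpleGraph W) (_hF : F.IsTree) : Type u := F.Dart

instance (F : SimpleGraph W) (hF : F.IsTree) : SeparationSystem (EdgeTreeSet F hF) where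
  le := dartLE (F := F)
  le_refl _ := Or.inl rfl
  le_trans _ _ _ h k := dartLE_trans hF.isAcyclic h k
  le_antisymm _ _ h k := dartLE_antisymm hF.isAcyclic h k
  inv d := Dart.symm d
  inv_inv d := Dart.symm_symm d
  inv_le_inv _ _ h := dartLE_symm h

end SimpleGraph

/-!
Call a set `P` of separations *inward* if it contains no small elements and any two of its elements
`r`, `s` satisfy `r ≤ s`, `s ≤ r` or `r ≤ inv s`. The orientation `O` is inward, since nestedness
leaves only one further possibility, which consistency excludes. Hence so is every `O_{≤ n}`, and
comparing the corridors of `O_{≤ m}` with those of `O_{≤ n}` for `m ≤ n` shows that their suprema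
`r`, `s` satisfy `r ≤ s` or `r ≤ inv s` (`sup_le_or_le_inv`). So the parliament is inward too.

In an inward set two elements with a common lower bound are comparable. Therefore corridors are
directed and their up-sets are chains. A corridor of `O_{≤ n}` being directed, its supremum has
order at most `n`. Each `π_n(O)` has at most one element above a given `s`, and any such element
for `n` is below the one for each larger `n`; so the intervals in a corridor `γ` of the parliament
are finite.

This makes the poset `γ` a rooted tree, growing downwards from a largest element or from an end. Its
Hasse diagram is a tree; if `γ` has a largest element, a new top vertex is added first.
Each `s ∈ γ` corresponds to the dart that leads from `s` to its upper cover. Finally, the ordering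
of a separation system is determined by that of an inward half of it: `s ≤ inv t` says that `s` and
`t` are incomparable, and `inv t ≤ s` never happens (`IsInwardHalf.nonempty_iso`). As `γ` is such a
half of `induced γ`, and the upward darts are such a half of the edge tree set, the isomorphism
between these halves extends.
-/

/-! ### Inward sets in separation systems -/

namespace SeparationSystem

variable {S : Type u} [SeparationSystem S] {r s t : S} {P γ : Set S}

theorem le_inv_comm (h : r ≤ inv s) : s ≤ inv r := by
  simpa only [inv_inv] using inv_le_inv _ _ h

theorem inv_le_comm (h : inv r ≤ s) : inv s ≤ r := by
  simpa only [inv_inv] using inv_le_inv _ _ h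

theorem inv_le_inv_iff : inv r ≤ inv s ↔ s ≤ r :=
  ⟨fun h => by simpa only [inv_inv] using le_inv_comm h, inv_le_inv _ _⟩

/-- A set of oriented separations is inward if it contains no small elements and any two of its
elements are comparable or point towards each other. -/
structure IsInward (P : Set S) : Prop where
  not_small : ∀ s ∈ P, ¬ s ≤ inv s
  le_or_le_or_le_inv : ∀ r ∈ P, ∀ s ∈ P, r ≤ s ∨ s ≤ r ∨ r ≤ inv s

namespace IsInward

theorem mono (hP : IsInward P) (h : γ ⊆ P) : IsInward γ :=
  ⟨fun s hs => hP.not_small s (h hs),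
    fun r hr s hs => hP.le_or_le_or_le_inv r (h hr) s (h hs)⟩

theorem le_or_le_of_le (hP : IsInward P) (hr : r ∈ P) (hs : s ∈ P) (ht : t ∈ P)
    (hrs : r ≤ s) (hrt : r ≤ t) : s ≤ t ∨ t ≤ s := by
  rcases hP.le_or_le_or_le_inv s hs t ht with h | h | h
  · exact Or.inl h
  · exact Or.inr h
  · exact absurd (hrs.trans (h.trans (inv_le_inv _ _ hrt))) (hP.not_small r hr)

theorem isCorridor_directed (hP : IsInward P) (hγ : IsCorridor P γ) (hr : r ∈ γ) (hs : s ∈ γ) :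
    ∃ t ∈ γ, r ≤ t ∧ s ≤ t := by
  obtain ⟨a, ha, rfl⟩ := hγ
  obtain ⟨-, b, hb, hab, hrb⟩ := hr
  obtain ⟨-, c, hc, hac, hsc⟩ := hs
  rcases hP.le_or_le_of_le ha hb hc hab hac with h | h
  · exact ⟨c, ⟨hc, c, hc, hac, le_rfl⟩, hrb.trans h, hsc⟩
  · exact ⟨b, ⟨hb, b, hb, hab, le_rfl⟩, hrb, hsc.trans h⟩

/-- An element of `P` that has an upper bound in `P` in common with an element of the corridor `γ`
lies in `γ`. -/
theorem mem_isCorridor (hP : IsInward P) (hγ : IsCorridor P γ) (hr : r ∈ γ) (hs : s ∈ P)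
    (ht : t ∈ P) (hrt : r ≤ t) (hst : s ≤ t) : s ∈ γ := by
  obtain ⟨a, ha, rfl⟩ := hγ
  obtain ⟨hrP, b, hb, hab, hrb⟩ := hr
  rcases hP.le_or_le_of_le hrP hb ht hrb hrt with h | h
  · exact ⟨hs, t, ht, hab.trans h, hst⟩
  · exact ⟨hs, b, hb, hab, hst.trans h⟩

end IsInward

theorem IsCorridor.subset (hγ : IsCorridor P γ) : γ ⊆ P := by
  obtain ⟨a, -, rfl⟩ := hγ
  exact fun x hx => hx.1

theorem IsCorridor.nonempty (hγ : IsCorridor P γ) : γ.Nonempty := by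
  obtain ⟨a, ha, rfl⟩ := hγ
  exact ⟨a, ha, a, ha, le_rfl, le_rfl⟩

theorem IsTreeSet.isInward {T O : Set S} (hT : IsTreeSet T) (hreg : IsRegular T)
    (hO : IsOrientation T O) (hcons : IsConsistent O) : IsInward O where
  not_small s hs := hreg s (hO.subset hs)
  le_or_le_or_le_inv r hr s hs := by
    rcases hT.nested r (hO.subset hr) s (hO.subset hs) with h | h | h | h
    · exact Or.inl h
    · exact Or.inr (Or.inr h)
    · by_cases hrs : r = s
      · exact Or.inl hrs.le
      · rcases h.lt_or_eq with h | h
        · exact absurd h (hcons r hr s hs hrs)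
        · exact absurd (hO.unique r hr (h ▸ hs)) (hT.not_degenerate r (hO.subset hr))
    · exact Or.inr (Or.inl (inv_le_inv_iff.1 h))

theorem isSubsystem_induced (P : Set S) : IsSubsystem (induced P) :=
  fun s hs => hs.elim (fun h => Or.inr (by rwa [inv_inv])) Or.inl

theorem IsInward.isTreeSet_induced (hP : IsInward P) (hreg : IsRegular (induced P)) :
    IsTreeSet (induced P) where
  subsystem := isSubsystem_induced P
  nested r hr s hs := by
    -- Nestedness does not depend on the orientations.
    have key : ∀ a ∈ P, ∀ b ∈ P, a ≤ b ∨ inv a ≤ inv b ∨ a ≤ inv b := fun a ha b hb =>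
      (hP.le_or_le_or_le_inv a ha b hb).imp_right (Or.imp_left (inv_le_inv _ _))
    unfold Nested
    rcases hr with hr | hr <;> rcases hs with hs | hs <;>
      rcases key _ hr _ hs with h | h | h <;> (try simp only [inv_inv] at h) <;> tauto
  not_trivial := by
    rintro s hs ⟨r, -, h, h'⟩
    exact hreg s hs (h.le.trans (le_inv_comm h'.le))
  not_degenerate s hs h := hreg s hs h.ge

/-! ### Isomorphisms from inward halves -/

/-- An inward set that contains exactly one of `s`, `inv s` for each `s`, in a separation system
without small elements. -/
structure IsInwardHalf (P : Set S) : Prop extends IsInward P where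
  mem_or_inv_mem : ∀ s, s ∈ P ∨ inv s ∈ P
  inv_notMem : ∀ s ∈ P, inv s ∉ P
  not_le_inv : ∀ s : S, ¬ s ≤ inv s

namespace IsInwardHalf

theorem not_inv_le (hP : IsInwardHalf P) (hr : r ∈ P) (hs : s ∈ P) : ¬ inv r ≤ s := by
  intro h
  rcases hP.le_or_le_or_le_inv r hr s hs with h' | h' | h'
  · exact hP.not_le_inv (inv s) ((inv_le_comm h).trans (by rwa [inv_inv]))
  · exact hP.not_le_inv (inv r) (h.trans (by rwa [inv_inv]))
  · have : inv r = s := le_antisymm h (le_inv_comm h')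
    exact hP.inv_notMem r hr (this ▸ hs)

theorem le_inv_iff (hP : IsInwardHalf P) (hr : r ∈ P) (hs : s ∈ P) :
    r ≤ inv s ↔ ¬ r ≤ s ∧ ¬ s ≤ r := by
  refine ⟨fun h => ⟨fun h' => ?_, fun h' => ?_⟩, fun h => ?_⟩
  · exact hP.not_le_inv r (h.trans (inv_le_inv _ _ h'))
  · exact hP.not_le_inv s (h'.trans h)
  · exact ((hP.le_or_le_or_le_inv r hr s hs).resolve_left h.1).resolve_left h.2

theorem nonempty_iso {S' : Type v} [SeparationSystem S'] {P' : Set S'} (hP : IsInwardHalf P)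
    (hP' : IsInwardHalf P') (f : P ≃o P') : Nonempty (Iso S S') := by
  classical
  have hinv : ∀ s, s ∉ P → inv s ∈ P := fun s h => (hP.mem_or_inv_mem s).resolve_left h
  let g : S → S' := fun s => if h : s ∈ P then f ⟨s, h⟩ else inv (f ⟨inv s, hinv s h⟩ : S')
  have g_of_mem : ∀ s : P, g s = f s := fun s => dif_pos s.2
  have g_inv_of_mem : ∀ s : P, g (inv (s : S)) = inv (f s : S') := fun s => by
    simp only [g, dif_neg (hP.inv_notMem s s.2), inv_inv]
  have mem_cases : ∀ s : S, (∃ a : P, s = a) ∨ ∃ a : P, s = inv (a : S) := fun s =>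
    (hP.mem_or_inv_mem s).imp (fun h => ⟨⟨s, h⟩, rfl⟩)
      (fun h => ⟨⟨inv s, h⟩, (inv_inv s).symm⟩)
  have hle : ∀ a b : P, (f a : S') ≤ f b ↔ (a : S) ≤ b := fun a b => f.le_iff_le
  have g_le : ∀ r s, g r ≤ g s ↔ r ≤ s := by
    intro r s
    rcases mem_cases r with ⟨a, rfl⟩ | ⟨a, rfl⟩ <;> rcases mem_cases s with ⟨b, rfl⟩ | ⟨b, rfl⟩ <;>
      simp only [g_of_mem, g_inv_of_mem]
    · exact hle a b
    · rw [hP.le_inv_iff a.2 b.2, hP'.le_inv_iff (f a).2 (f b).2, hle, hle]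
    · exact iff_of_false (hP'.not_inv_le (f a).2 (f b).2) (hP.not_inv_le a.2 b.2)
    · rw [inv_le_inv_iff, inv_le_inv_iff, hle]
  have g_surj : Function.Surjective g := by
    intro s'
    rcases hP'.mem_or_inv_mem s' with h | h
    · exact ⟨f.symm ⟨s', h⟩, by simp [g_of_mem]⟩
    · exact ⟨inv (f.symm ⟨inv s', h⟩ : S), by simp [g_inv_of_mem, inv_inv]⟩
  refine ⟨{ RelIso.ofSurjective (OrderEmbedding.ofMapLEIff g g_le) g_surj with
    map_inv := fun s => ?_ }⟩
  change g (inv s) = inv (g s)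
  rcases mem_cases s with ⟨a, rfl⟩ | ⟨a, rfl⟩
  · rw [g_inv_of_mem, g_of_mem]
  · rw [inv_inv, g_inv_of_mem, g_of_mem, inv_inv]

end IsInwardHalf

/-- A directed inward set whose inverses are not small either is an inward half of the system that
it induces. -/
theorem IsInward.isInwardHalf_induced (hP : IsInward P) (hreg : IsRegular (induced P))
    (hdir : ∀ r ∈ P, ∀ s ∈ P, ∃ t ∈ P, r ≤ t ∧ s ≤ t) :
    IsInwardHalf {s : induced P | (s : S) ∈ P} where
  not_small s _ := hreg s s.2
  le_or_le_or_le_inv r hr s hs := hP.le_or_le_or_le_inv r hr s hs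
  mem_or_inv_mem s := s.2
  inv_notMem s hs hs' := by
    obtain ⟨t, ht, h, h'⟩ := hdir _ hs _ hs'
    refine hreg (inv t) (isSubsystem_induced P t (Or.inl ht)) ?_
    rw [inv_inv]
    exact (inv_le_comm h').trans h
  not_le_inv s := hreg s s.2

end SeparationSystem

/-! ### The Hasse diagram of a downward growing tree order -/

namespace SimpleGraph

variable {W : Type u} [PartialOrder W]

theorem covBy_unique (hchain : ∀ a b c : W, a ≤ b → a ≤ c → b ≤ c ∨ c ≤ b) {a b c : W}
    (hb : a ⋖ b) (hc : a ⋖ c) : b = c := by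
  rcases hchain a b c hb.le hc.le with h | h
  · exact hc.eq_or_eq hb.le h |>.resolve_left hb.ne'
  · exact (hb.eq_or_eq hc.le h |>.resolve_left hc.ne').symm

variable [LocallyFiniteOrder W]

theorem covBy_le_of_lt (hchain : ∀ a b c : W, a ≤ b → a ≤ c → b ≤ c ∨ c ≤ b) {a b c : W}
    (hb : a ⋖ b) (hc : a < c) : b ≤ c := by
  obtain ⟨d, hd, hdc⟩ := exists_covBy_le_of_lt hc
  exact covBy_unique hchain hb hd ▸ hdc

theorem hasse_reachable_of_le {a b : W} (h : a ≤ b) : (hasse W).Reachable a b := by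
  rw [reachable_iff_reflTransGen]
  exact Relation.ReflTransGen.mono (fun _ _ => Or.inl) _ _ (le_iff_reflTransGen_covBy.1 h)

theorem hasse_isTree [Nonempty W] (hdir : ∀ a b : W, ∃ c, a ≤ c ∧ b ≤ c)
    (hchain : ∀ a b c : W, a ≤ b → a ≤ c → b ≤ c ∨ c ≤ b) : (hasse W).IsTree := by
  refine ⟨⟨fun a b => ?_⟩, isAcyclic_iff_forall_adj_isBridge.2 ?_⟩
  · obtain ⟨c, hac, hbc⟩ := hdir a b
    exact (hasse_reachable_of_le hac).trans (hasse_reachable_of_le hbc).symm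
  -- The edge `ab` is the only one that leaves the down-set of its lower end `a`.
  have key : ∀ a b : W, a ⋖ b → (hasse W).IsBridge s(a, b) := by
    intro a b hab
    rw [isBridge_iff, reachable_iff_reflTransGen]
    suffices ∀ c, Relation.ReflTransGen ((hasse W).deleteEdges {s(a, b)}).Adj a c → c ≤ a from
      fun h => hab.lt.not_ge (this b h)
    intro c h
    induction h with
    | refl => exact le_rfl
    | @tail y z _ hyz ih =>
      rw [deleteEdges_adj] at hyz
      obtain ⟨hyz | hyz, hne⟩ := hyz
      · rcases ih.eq_or_lt with rfl | hlt
        · exact absurd (by rw [covBy_unique hchain hyz hab]; rfl) hne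
        · exact covBy_le_of_lt hchain hyz hlt
      · exact hyz.le.trans ih
  rintro a b (h | h)
  · exact key a b h
  · rw [Sym2.eq_swap]
    exact key b a h

theorem not_dartLE_symm {V : Type u} {F : SimpleGraph V} (d : F.Dart) : ¬ dartLE d d.symm := by
  rintro (h | ⟨h, -⟩)
  · exact d.symm_ne h.symm
  · exact h (by simp)

theorem dartLE_of_snd_eq_fst {V : Type u} {F : SimpleGraph V} {d e : F.Dart} (h : d.snd = e.fst)
    (hne : d.fst ≠ e.snd) : dartLE d e := by
  obtain ⟨⟨a, b⟩, hd⟩ := d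
  obtain ⟨⟨b', c⟩, he⟩ := e
  obtain rfl : b = b' := h
  have hd' : F.Adj a b := hd
  have he' : F.Adj b c := he
  refine Or.inr ⟨fun h => hne ?_, Walk.nil, Walk.IsPath.nil, ?_, ?_⟩
  · have h' : s(a, b) = s(b, c) := h
    rcases Sym2.eq_iff.1 h' with h | h
    · exact absurd h.1 hd'.ne
    · exact h.1
  · simpa using hd'.ne
  · simpa using he'.ne'

/-- The darts of the Hasse diagram that lead from an element to its upper cover. -/
def upDarts (W : Type u) [PartialOrder W] : Set (hasse W).Dart := {d | d.fst ⋖ d.snd}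

theorem dartLE_of_fst_le (hF : (hasse W).IsAcyclic)
    (hchain : ∀ a b c : W, a ≤ b → a ≤ c → b ≤ c ∨ c ≤ b) {d e : (hasse W).Dart}
    (hd : d ∈ upDarts W) (he : e ∈ upDarts W) (h : d.fst ≤ e.fst) : dartLE d e := by
  have key : ∀ x, Relation.ReflTransGen (· ⋖ ·) d.fst x →
      ∀ e ∈ upDarts W, e.fst = x → dartLE d e := by
    intro x hx
    induction hx with
    | refl =>
      intro e he hed
      refine Or.inl (Dart.ext _ _ (Prod.ext hed.symm ?_))
      refine covBy_unique hchain hd (c := e.snd) ?_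
      rw [← hed]
      exact he
    | @tail y z _ hyz ih =>
      rintro e he rfl
      refine dartLE_trans hF (ih ⟨(y, e.fst), Or.inl hyz⟩ hyz rfl) (dartLE_of_snd_eq_fst rfl ?_)
      exact (hyz.lt.trans (CovBy.lt he)).ne
  exact key _ (le_iff_reflTransGen_covBy.1 h) e he rfl

theorem dartLE_symm_of_not_le (hF : (hasse W).IsAcyclic) (hdir : ∀ a b : W, ∃ c, a ≤ c ∧ b ≤ c)
    (hchain : ∀ a b c : W, a ≤ b → a ≤ c → b ≤ c ∨ c ≤ b) {d e : (hasse W).Dart}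
    (hd : d ∈ upDarts W) (he : e ∈ upDarts W) (h : ¬ d.fst ≤ e.fst) (h' : ¬ e.fst ≤ d.fst) :
    dartLE d e.symm := by
  -- The path from `d` to `e` turns at the least common upper bound `z` of their lower ends.
  obtain ⟨w, hdw, hew⟩ := hdir d.fst e.fst
  have hfin : {z ∈ Set.Icc d.fst w | e.fst ≤ z}.Finite := (Set.finite_Icc _ _).subset fun _ h => h.1
  obtain ⟨z, hz⟩ := hfin.exists_minimal ⟨w, ⟨hdw, le_rfl⟩, hew⟩
  obtain ⟨x, hdx, hxz⟩ := exists_le_covBy_of_lt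
    (hz.prop.1.1.lt_of_ne fun hdz => h' (hdz ▸ hz.prop.2))
  obtain ⟨y, hey, hyz⟩ := exists_le_covBy_of_lt
    (hz.prop.2.lt_of_ne fun hez => h (hez ▸ hz.prop.1.1))
  have hxy : x ≠ y := by
    rintro rfl
    exact hxz.lt.not_ge (hz.le_of_le ⟨⟨hdx, hxz.le.trans hz.prop.1.2⟩, hey⟩ hxz.le)
  let dx : (hasse W).Dart := ⟨(x, z), Or.inl hxz⟩
  let dy : (hasse W).Dart := ⟨(y, z), Or.inl hyz⟩
  have h1 : dartLE d dx := dartLE_of_fst_le hF hchain hd hxz hdx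
  have h2 : dartLE dx dy.symm := dartLE_of_snd_eq_fst rfl hxy
  have h3 : dartLE e dy := dartLE_of_fst_le hF hchain he hyz hey
  exact dartLE_trans hF (dartLE_trans hF h1 h2) (dartLE_symm h3)

open SeparationSystem

theorem isInwardHalf_upDarts (hF : (hasse W).IsTree) (hdir : ∀ a b : W, ∃ c, a ≤ c ∧ b ≤ c)
    (hchain : ∀ a b c : W, a ≤ b → a ≤ c → b ≤ c ∨ c ≤ b) :
    IsInwardHalf (S := EdgeTreeSet (hasse W) hF) (upDarts W) where
  not_small d _ := not_dartLE_symm d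
  le_or_le_or_le_inv d hd e he := by
    by_cases h : d.fst ≤ e.fst
    · exact Or.inl (dartLE_of_fst_le hF.isAcyclic hchain hd he h)
    by_cases h' : e.fst ≤ d.fst
    · exact Or.inr (Or.inl (dartLE_of_fst_le hF.isAcyclic hchain he hd h'))
    · exact Or.inr (Or.inr (dartLE_symm_of_not_le hF.isAcyclic hdir hchain hd he h h'))
  mem_or_inv_mem d := d.adj
  inv_notMem _ hd hd' := (CovBy.lt hd).not_gt (CovBy.lt hd')
  not_le_inv d := not_dartLE_symm d

theorem dartLE_iff_fst_le (hF : (hasse W).IsTree) (hdir : ∀ a b : W, ∃ c, a ≤ c ∧ b ≤ c)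
    (hchain : ∀ a b c : W, a ≤ b → a ≤ c → b ≤ c ∨ c ≤ b) {d e : (hasse W).Dart}
    (hd : d ∈ upDarts W) (he : e ∈ upDarts W) : dartLE d e ↔ d.fst ≤ e.fst := by
  refine ⟨fun h => ?_, dartLE_of_fst_le hF.isAcyclic hchain hd he⟩
  by_contra hde
  by_cases h' : e.fst ≤ d.fst
  · exact hde (by rw [dartLE_antisymm hF.isAcyclic h
      (dartLE_of_fst_le hF.isAcyclic hchain he hd h')])
  · exact not_dartLE_symm d (dartLE_trans hF.isAcyclic h
      (dartLE_symm (dartLE_symm_of_not_le hF.isAcyclic hdir hchain hd he hde h')))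

/-- The upward darts are ordered as the non-maximal elements from which they start. -/
theorem nonempty_orderIso_upDarts (hF : (hasse W).IsTree)
    (hdir : ∀ a b : W, ∃ c, a ≤ c ∧ b ≤ c)
    (hchain : ∀ a b c : W, a ≤ b → a ≤ c → b ≤ c ∨ c ≤ b) {P : Type v} [PartialOrder P]
    (φ : P ↪o W) (hφ : ∀ a, a ∈ Set.range φ ↔ ¬ IsMax a) :
    Nonempty (P ≃o {d : EdgeTreeSet (hasse W) hF | d ∈ upDarts W}) := by
  have hcov : ∀ p, ∃ b, φ p ⋖ b := fun p => by
    obtain ⟨b, hb⟩ := not_isMax_iff.1 ((hφ _).1 ⟨p, rfl⟩)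
    obtain ⟨c, hc, -⟩ := exists_covBy_le_of_lt hb
    exact ⟨c, hc⟩
  choose b hb using hcov
  let g : P → {d : EdgeTreeSet (hasse W) hF | d ∈ upDarts W} :=
    fun p => ⟨(⟨(φ p, b p), Or.inl (hb p)⟩ : (hasse W).Dart), hb p⟩
  refine ⟨RelIso.ofSurjective (OrderEmbedding.ofMapLEIff g fun p q => ?_) ?_⟩
  · exact (dartLE_iff_fst_le hF hdir hchain (g p).2 (g q).2).trans φ.le_iff_le
  · rintro ⟨(d : (hasse W).Dart), hd⟩
    have hd' : d.fst ⋖ d.snd := hd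
    obtain ⟨p, hp⟩ := (hφ (d.fst)).2 (not_isMax_of_lt hd'.lt)
    refine ⟨p, Subtype.ext (Dart.ext _ _ (Prod.ext hp ?_))⟩
    exact covBy_unique hchain (hb p) (hp ▸ hd')

end SimpleGraph

namespace SeparationSystem

open SimpleGraph

theorem IsInwardHalf.exists_iso_of_embedding {S : Type u} [SeparationSystem S] {P : Set S}
    (hP : IsInwardHalf P) {W : Type u} [PartialOrder W] [LocallyFiniteOrder W] [Nonempty W]
    (hdir : ∀ a b : W, ∃ c, a ≤ c ∧ b ≤ c)
    (hchain : ∀ a b c : W, a ≤ b → a ≤ c → b ≤ c ∨ c ≤ b)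
    (φ : P ↪o W) (hφ : ∀ a, a ∈ Set.range φ ↔ ¬ IsMax a) :
    ∃ (W : Type u) (F : SimpleGraph W) (hF : F.IsTree), Nonempty (Iso S (EdgeTreeSet F hF)) := by
  have hF := hasse_isTree hdir hchain
  obtain ⟨f⟩ := nonempty_orderIso_upDarts hF hdir hchain φ hφ
  exact ⟨W, hasse W, hF, hP.nonempty_iso (isInwardHalf_upDarts hF hdir hchain) f⟩

theorem IsInwardHalf.exists_iso_edgeTreeSet {S : Type u} [SeparationSystem S] {P : Set S}
    (hP : IsInwardHalf P) (hne : P.Nonempty) (hdir : ∀ r ∈ P, ∀ s ∈ P, ∃ t ∈ P, r ≤ t ∧ s ≤ t)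
    (hfin : ∀ r ∈ P, ∀ s ∈ P, {t ∈ P | r ≤ t ∧ t ≤ s}.Finite) :
    ∃ (W : Type u) (F : SimpleGraph W) (hF : F.IsTree), Nonempty (Iso S (EdgeTreeSet F hF)) := by
  classical
  have : Nonempty P := hne.to_subtype
  have hdir' : ∀ a b : P, ∃ c, a ≤ c ∧ b ≤ c := fun a b => by
    obtain ⟨c, hc, h⟩ := hdir a a.2 b b.2
    exact ⟨⟨c, hc⟩, h⟩
  have hchain : ∀ a b c : P, a ≤ b → a ≤ c → b ≤ c ∨ c ≤ b := fun a b c hb hc =>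
    hP.le_or_le_of_le a.2 b.2 c.2 hb hc
  let : LocallyFiniteOrder P := LocallyFiniteOrder.ofFiniteIcc fun a b =>
    Set.Finite.of_finite_image ((hfin a a.2 b b.2).subset (by
      rintro _ ⟨c, hc, rfl⟩
      exact ⟨c.2, hc⟩)) Subtype.val_injective.injOn
  by_cases hmax : ∃ m : P, IsMax m
  · obtain ⟨m, hm⟩ := hmax
    let : OrderTop P :=
      { top := m
        le_top := fun a => by
          obtain ⟨c, hac, hmc⟩ := hdir' a m
          exact hac.trans (hm hmc) }
    refine hP.exists_iso_of_embedding (W := WithTop P) (fun a b => ⟨⊤, le_top, le_top⟩) ?_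
      WithTop.coeOrderHom fun a => ?_
    · intro a b c hab hac
      induction b with
      | top => exact Or.inr le_top
      | coe b =>
        induction c with
        | top => exact Or.inl le_top
        | coe c =>
          induction a with
          | top => exact absurd hab (by simp)
          | coe a => exact_mod_cast hchain a b c (by exact_mod_cast hab) (by exact_mod_cast hac)
    · rw [isMax_iff_eq_top]
      induction a with
      | top => simp
      | coe a => exact iff_of_true ⟨a, rfl⟩ (WithTop.coe_ne_top)
  · push Not at hmax
    exact hP.exists_iso_of_embedding hdir' hchain (RelEmbedding.refl _) fun a =>
      iff_of_true ⟨a, rfl⟩ (hmax a)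

end SeparationSystem

/-! ### The parliament -/

namespace GraphSep

open SeparationSystem

variable {V : Type u} {G : SimpleGraph V} {O γ γ' : Set (GraphSep G)} {m n : ℕ} {r s t : GraphSep G}

theorem le_sup (hs : s ∈ γ) : s ≤ sup γ :=
  ⟨Set.subset_biUnion_of_mem (u := GraphSep.A) hs, Set.biInter_subset_of_mem hs⟩

theorem sup_le (h : ∀ r ∈ γ, r ≤ s) : sup γ ≤ s :=
  ⟨Set.iUnion₂_subset fun r hr => (h r hr).1, Set.subset_iInter₂ fun r hr => (h r hr).2⟩

theorem orderLE_subset : orderLE O n ⊆ O := fun _ h => h.1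

theorem orderLE_mono (h : m ≤ n) : orderLE O m ⊆ orderLE O n :=
  fun _ hs => ⟨hs.1, hs.2.trans (by exact_mod_cast h)⟩

/-- Every finite part of the separator of the supremum of a directed set lies in the separator of
one of its elements. -/
theorem encard_separator_sup_le (hne : γ.Nonempty)
    (hdir : ∀ r ∈ γ, ∀ s ∈ γ, ∃ t ∈ γ, r ≤ t ∧ s ≤ t)
    (hn : ∀ s ∈ γ, s.separator.encard ≤ n) : (sup γ).separator.encard ≤ n := by
  have key : ∀ X : Set V, X.Finite → X ⊆ (sup γ).separator → ∃ s ∈ γ, X ⊆ s.separator := by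
    intro X hX
    induction X, hX using Set.Finite.induction_on with
    | empty => exact fun _ => hne.imp fun s hs => ⟨hs, Set.empty_subset _⟩
    | @insert x X _ _ ih =>
      intro h
      obtain ⟨s, hs, hXs⟩ := ih ((Set.subset_insert _ _).trans h)
      obtain ⟨r, hr, hxr⟩ := Set.mem_iUnion₂.1 (h (Set.mem_insert x X)).1
      obtain ⟨t, ht, hrt, hst⟩ := hdir r hr s hs
      refine ⟨t, ht, fun y hy => ⟨?_, Set.mem_iInter₂.1 (h hy).2 t ht⟩⟩
      rcases hy with rfl | hy
      · exact hrt.1 hxr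
      · exact hst.1 (hXs hy).1
  by_contra! hlt
  obtain ⟨X, hX, hXn⟩ := Set.exists_subset_encard_eq (k := (n + 1 : ℕ))
    (by exact_mod_cast Order.add_one_le_of_lt hlt)
  obtain ⟨s, hs, hXs⟩ := key X (Set.finite_of_encard_eq_coe hXn) hX
  have := (Set.encard_le_encard hXs).trans (hn s hs)
  rw [hXn] at this
  exact absurd (by exact_mod_cast this) (Nat.not_succ_le_self n)

theorem sup_le_or_le_inv (hO : IsInward O) (hmn : m ≤ n) (hγ : IsCorridor (orderLE O m) γ)
    (hγ' : IsCorridor (orderLE O n) γ') : sup γ ≤ sup γ' ∨ sup γ ≤ inv (sup γ') := by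
  have hn : IsInward (orderLE O n) := hO.mono orderLE_subset
  have hγn : γ ⊆ orderLE O n := hγ.subset.trans (orderLE_mono hmn)
  by_cases h : ∃ s ∈ γ, s ∈ γ'
  · obtain ⟨s, hs, hs'⟩ := h
    refine Or.inl (sup_le fun r hr => le_sup ?_)
    obtain ⟨t, ht, hst, hrt⟩ := (hO.mono orderLE_subset).isCorridor_directed hγ hs hr
    exact hn.mem_isCorridor hγ' hs' (hγn hr) (hγn ht) hst hrt
  · push Not at h
    refine Or.inr (sup_le fun r hr => le_inv_comm (sup_le fun s hs => le_inv_comm ?_))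
    have hs' := hγ'.subset hs
    rcases hn.le_or_le_or_le_inv r (hγn hr) s hs' with hrs | hrs | hrs
    · exact absurd (hn.mem_isCorridor hγ' hs (hγn hr) hs' le_rfl hrs) (h r hr)
    · exact absurd (hn.mem_isCorridor hγ' hs (hγn hr) (hγn hr) hrs le_rfl) (h r hr)
    · exact hrs

theorem isInward_parliament (hO : IsInward O) (hreg : IsRegular (induced (parliament O))) :
    IsInward (parliament O) where
  not_small s hs := hreg s (Or.inl hs)
  le_or_le_or_le_inv r hr s hs := by
    obtain ⟨m, γ, hγ, rfl⟩ := Set.mem_iUnion.1 hr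
    obtain ⟨n, γ', hγ', rfl⟩ := Set.mem_iUnion.1 hs
    rcases le_total m n with h | h
    · exact (sup_le_or_le_inv hO h hγ hγ').imp_right Or.inr
    · exact Or.inr ((sup_le_or_le_inv hO h hγ' hγ).imp_right le_inv_comm)

theorem parliament_subset_finiteOrder (hO : IsInward O) : parliament O ⊆ finiteOrder G := by
  rintro s hs
  obtain ⟨n, γ, hγ, rfl⟩ := Set.mem_iUnion.1 hs
  have := encard_separator_sup_le hγ.nonempty
    (fun r hr s hs => (hO.mono orderLE_subset).isCorridor_directed hγ hr hs)
    (fun s hs => (hγ.subset hs).2)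
  exact Set.finite_of_encard_le_coe this

theorem le_of_mem_parliamentLevel (hO : IsInward O) (hmn : m ≤ n) (hr : ¬ r ≤ inv r)
    (hs : s ∈ parliamentLevel O m) (ht : t ∈ parliamentLevel O n) (hrs : r ≤ s) (hrt : r ≤ t) :
    s ≤ t := by
  obtain ⟨γ, hγ, rfl⟩ := hs
  obtain ⟨γ', hγ', rfl⟩ := ht
  exact (sup_le_or_le_inv hO hmn hγ hγ').resolve_right fun h =>
    hr (hrs.trans (h.trans (inv_le_inv _ _ hrt)))

theorem finite_parliament_between (hO : IsInward O) (hr : ¬ r ≤ inv r)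
    (ht : t ∈ parliament O) : {s ∈ parliament O | r ≤ s ∧ s ≤ t}.Finite := by
  obtain ⟨n, ht⟩ := Set.mem_iUnion.1 ht
  have hsub : {s ∈ parliament O | r ≤ s ∧ s ≤ t} ⊆
      {t} ∪ ⋃ k ∈ Set.Iio n, {s ∈ parliamentLevel O k | r ≤ s} := by
    rintro s ⟨hs, hrs, hst⟩
    obtain ⟨k, hs⟩ := Set.mem_iUnion.1 hs
    rcases lt_or_ge k n with hk | hk
    · exact Or.inr (Set.mem_biUnion (x := k) hk ⟨hs, hrs⟩)
    · exact Or.inl (hst.antisymm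
        (le_of_mem_parliamentLevel hO hk hr ht hs (hrs.trans hst) hrs))
  refine ((Set.finite_singleton t).union ((Set.finite_Iio n).biUnion fun k _ => ?_)).subset hsub
  refine Set.Subsingleton.finite fun a ha b hb => le_antisymm ?_ ?_
  · exact le_of_mem_parliamentLevel hO le_rfl hr ha.1 hb.1 ha.2 hb.2
  · exact le_of_mem_parliamentLevel hO le_rfl hr hb.1 ha.1 hb.2 ha.2

end GraphSep

open SeparationSystem GraphSep in
theorem theorem3p8 {V : Type u} (G : SimpleGraph V) (T O : Set (GraphSep G))
    (hT : IsTreeSet T) (hTreg : IsRegular T) (hTfin : T ⊆ finiteOrder G)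
    (hO : IsOrientation T O) (hOcons : IsConsistent O)
    (hreg : IsRegular (induced (parliament O)))
    (γ : Set (GraphSep G)) (hγ : IsCorridor (parliament O) γ) :
    induced γ ⊆ finiteOrder G ∧ IsTreeSet (induced γ) ∧ IsRegular (induced γ) ∧
      ∃ (W : Type u) (F : SimpleGraph W) (hF : F.IsTree),
        Nonempty (Iso (induced γ) (SimpleGraph.EdgeTreeSet F hF)) := by
  have hOin : IsInward O := hT.isInward hTreg hO hOcons
  have hπ : IsInward (parliament O) := isInward_parliament hOin hreg
  have hsub : γ ⊆ parliament O := hγ.subset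
  have hγin : IsInward γ := hπ.mono hsub
  have hγreg : IsRegular (induced γ) := fun s hs => hreg s (hs.imp (@hsub _) (@hsub _))
  have hdir : ∀ r ∈ γ, ∀ s ∈ γ, ∃ t ∈ γ, r ≤ t ∧ s ≤ t := fun r hr s hs =>
    hπ.isCorridor_directed hγ hr hs
  refine ⟨?_, hγin.isTreeSet_induced hγreg, hγreg, ?_⟩
  · rintro s (hs | hs)
    · exact parliament_subset_finiteOrder hOin (hsub hs)
    · have : (s.B ∩ s.A).Finite := parliament_subset_finiteOrder hOin (hsub hs)
      change (s.A ∩ s.B).Finite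
      rwa [Set.inter_comm]
  · refine (hγin.isInwardHalf_induced hγreg hdir).exists_iso_edgeTreeSet ?_ ?_ ?_
    · obtain ⟨s, hs⟩ := hγ.nonempty
      exact ⟨⟨s, Or.inl hs⟩, hs⟩
    · intro r hr s hs
      obtain ⟨t, ht, h⟩ := hdir r hr s hs
      exact ⟨⟨t, Or.inl ht⟩, ht, h⟩
    · intro r hr s hs
      refine Set.Finite.of_finite_image ((finite_parliament_between hOin
        (hγin.not_small r hr) (hsub hs)).subset ?_) Subtype.val_injective.injOn
      rintro _ ⟨t, ⟨ht, h⟩, rfl⟩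
      exact ⟨hsub ht, h⟩
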